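/- Let $k\ge 1$ be an integer and $1\le p<\infty$. For a Banach space $X$ over $\mathbb K\in\{\mathbb R,\mathbb C\}$ let $\bigotimes_{s,k}X$ denote the space of symmetric tensors, i.e. the linear span of the tensors $x\otimes\cdots\otimes x$ ($k$ factors, $x\in X$) in the algebraic $k$-fold tensor product $\bigotimes_k X$. On it consider the symmetric projective norm $$\pi_s(u)=\inf\Big\{\sum_{j}|c_j|\,\|x_j\|^k:\ u=\sum_j c_j\,x_j\otimes\cdots\otimes x_j\ \text{(finite sum)}\Big\}$$ and the restriction of the projective norm $$\pi(u)=\inf\Big\{\sum_{j}\|x_{1,j}\|\cdots\|x_{k,j}\|:\ u=\sum_j x_{1,j}\otimes\cdots\otimes x_{k,j}\ \text{(finite sum)}\Big\}.$$ Take $X=\ell_p$ with unit vectors $e_n$, and let the tensor diagonal $D_{k,p}$ be the closed linear span of the elements $e_n\otimes\cdots\otimes e_n$, $n\in\mathbb N$, in the completion of $\bigotimes_{s,k}\ell_p$ with respect to one of these norms. Suppose that either the norm is $\pi_s$ and $\mathbb K=\mathbb C$, or the norm is $\pi$ and $\mathbb K\in\{\mathbb R,\mathbb C\}$. Then: 1.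 if $k<p<\infty$, then $D_{k,p}$ is isometrically isomorphic to $\ell_{p/k}$; 2. if $1\le p\le k$, then $D_{k,p}$ is isometrically isomorphic to $\ell_1$. In both cases there is a surjective linear isometry that sends $e_n\otimes\cdots\otimes e_n$ to the unit vector $e_n$ for every $n$. -/

import Mathlib

open scoped ENNReal TensorProduct
open UniformSpace (Completion)

noncomputable section

section SymmetricTensors

variable (𝕜 : Type*) [RCLike 𝕜] (k : ℕ) (X : Type*) [NormedAddCommGroup X] [NormedSpace 𝕜 X]

/-- The `k`-fold symmetric tensors over `X`: the linear span of the tensors `x ⊗ ⋯ ⊗ x` inside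
the algebraic `k`-fold tensor product. As a subspace of `⨂[𝕜] _ : Fin k, X` it carries the
restriction of the projective (semi)norm `π`. -/
def symmetricTensors : Submodule 𝕜 (⨂[𝕜] _ : Fin k, X) :=
  Submodule.span 𝕜 (Set.range fun x : X => PiTensorProduct.tprod 𝕜 fun _ : Fin k => x)

variable {X} in
/-- The tensor `x ⊗ ⋯ ⊗ x` (`k` factors) as a symmetric tensor. -/
def tensorPow (x : X) : symmetricTensors 𝕜 k X :=
  ⟨PiTensorProduct.tprod 𝕜 fun _ : Fin k => x, Submodule.subset_span ⟨x, rfl⟩⟩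

variable {X} in
/-- The costs `∑ |cⱼ| ‖xⱼ‖ ^ k` of the representations `u = ∑ cⱼ xⱼ ⊗ ⋯ ⊗ xⱼ` of a symmetric
tensor `u`. -/
def symmetricCosts (u : symmetricTensors 𝕜 k X) : Set ℝ :=
  {r | ∃ (n : ℕ) (c : Fin n → 𝕜) (x : Fin n → X),
    u = ∑ j, c j • tensorPow 𝕜 k (x j) ∧ r = ∑ j, ‖c j‖ * ‖x j‖ ^ k}

theorem symmetricCosts_bddBelow (u : symmetricTensors 𝕜 k X) :
    BddBelow (symmetricCosts 𝕜 k u) := by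
  refine ⟨0, ?_⟩
  rintro r ⟨n, c, x, -, rfl⟩
  positivity

theorem symmetricCosts_add {u v : symmetricTensors 𝕜 k X} {r s : ℝ}
    (hr : r ∈ symmetricCosts 𝕜 k u) (hs : s ∈ symmetricCosts 𝕜 k v) :
    r + s ∈ symmetricCosts 𝕜 k (u + v) := by
  obtain ⟨m, c, x, rfl, rfl⟩ := hr
  obtain ⟨n, d, y, rfl, rfl⟩ := hs
  exact ⟨m + n, Fin.append c d, Fin.append x y, by simp [Fin.sum_univ_add],
    by simp [Fin.sum_univ_add]⟩

theorem symmetricCosts_smul (a : 𝕜) {u : symmetricTensors 𝕜 k X} {r : ℝ}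
    (hr : r ∈ symmetricCosts 𝕜 k u) : ‖a‖ * r ∈ symmetricCosts 𝕜 k (a • u) := by
  obtain ⟨m, c, x, rfl, rfl⟩ := hr
  exact ⟨m, fun j => a * c j, x, by simp [Finset.smul_sum, mul_smul],
    by simp [Finset.mul_sum, mul_assoc]⟩

theorem symmetricCosts_nonempty (u : symmetricTensors 𝕜 k X) :
    (symmetricCosts 𝕜 k u).Nonempty := by
  obtain ⟨u, hu⟩ := u
  refine Submodule.span_induction (p := fun u hu => (symmetricCosts 𝕜 k
    (⟨u, hu⟩ : symmetricTensors 𝕜 k X)).Nonempty) ?_ ?_ ?_ ?_ hu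
  · rintro _ ⟨x, rfl⟩
    exact ⟨_, 1, fun _ => 1, fun _ => x, by simp [tensorPow], rfl⟩
  · exact ⟨_, 0, Fin.elim0, Fin.elim0, by simp; rfl, rfl⟩
  · rintro u v hu hv ⟨r, hr⟩ ⟨s, hs⟩
    exact ⟨_, symmetricCosts_add 𝕜 k X hr hs⟩
  · rintro a u hu ⟨r, hr⟩
    exact ⟨_, symmetricCosts_smul 𝕜 k X a hr⟩

/-- The symmetric projective (semi)norm
`π_s u = inf {∑ |cⱼ| ‖xⱼ‖ ^ k : u = ∑ cⱼ xⱼ ⊗ ⋯ ⊗ xⱼ}` on the symmetric tensors. -/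
def symmetricProjectiveSeminorm : Seminorm 𝕜 (symmetricTensors 𝕜 k X) :=
  .ofSMulLE (fun u => sInf (symmetricCosts 𝕜 k u))
    (le_antisymm
      (csInf_le (symmetricCosts_bddBelow 𝕜 k X 0) ⟨0, Fin.elim0, Fin.elim0, by simp, by simp⟩)
      (le_csInf (symmetricCosts_nonempty 𝕜 k X 0) (by
        rintro r ⟨n, c, x, -, rfl⟩
        positivity)))
    (fun u v => by
      rw [← csInf_add (symmetricCosts_nonempty 𝕜 k X u) (symmetricCosts_bddBelow 𝕜 k X u)
        (symmetricCosts_nonempty 𝕜 k X v) (symmetricCosts_bddBelow 𝕜 k X v)]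
      refine csInf_le_csInf (symmetricCosts_bddBelow 𝕜 k X _)
        ((symmetricCosts_nonempty 𝕜 k X u).add (symmetricCosts_nonempty 𝕜 k X v)) ?_
      rintro _ ⟨r, hr, s, hs, rfl⟩
      exact symmetricCosts_add 𝕜 k X hr hs)
    (fun a u => by
      have h := Real.sInf_smul_of_nonneg (norm_nonneg a) (symmetricCosts 𝕜 k u)
      rw [smul_eq_mul] at h
      rw [← h]
      refine csInf_le_csInf (symmetricCosts_bddBelow 𝕜 k X _)
        ((symmetricCosts_nonempty 𝕜 k X u).smul_set) ?_
      rintro _ ⟨r, hr, rfl⟩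
      exact symmetricCosts_smul 𝕜 k X a hr)

/-- The symmetric tensors, normed by the symmetric projective norm `π_s` (and not by the
restriction of `π`). -/
def SymmetricProjectiveTensor : Type _ := symmetricTensors 𝕜 k X

instance : AddCommGroup (SymmetricProjectiveTensor 𝕜 k X) :=
  inferInstanceAs (AddCommGroup (symmetricTensors 𝕜 k X))

instance : Module 𝕜 (SymmetricProjectiveTensor 𝕜 k X) :=
  inferInstanceAs (Module 𝕜 (symmetricTensors 𝕜 k X))

instance : SeminormedAddCommGroup (SymmetricProjectiveTensor 𝕜 k X) :=
  AddGroupSeminorm.toSeminormedAddCommGroup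
    (E := SymmetricProjectiveTensor 𝕜 k X)
    (symmetricProjectiveSeminorm 𝕜 k X).toAddGroupSeminorm

instance : NormedSpace 𝕜 (SymmetricProjectiveTensor 𝕜 k X) where
  norm_smul_le a u := (map_smul_eq_mul (symmetricProjectiveSeminorm 𝕜 k X) a u).le

end SymmetricTensors

section Diagonal

variable (𝕜 : Type*) [RCLike 𝕜] (k : ℕ) (p : ℝ≥0∞) [Fact (1 ≤ p)]

/-- The sequence space `ℓ_p` with scalars `𝕜`. -/
abbrev ellp (𝕜 : Type*) [RCLike 𝕜] (p : ℝ≥0∞) : Type _ := lp (fun _ : ℕ => 𝕜) p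

/-- The unit vector `e_n` of `ℓ_p`. -/
def unitVec (n : ℕ) : ellp 𝕜 p := lp.single p n (1 : 𝕜)

/-- `e_n ⊗ ⋯ ⊗ e_n` in the completion of the symmetric tensors over `ℓ_p` with respect to the
symmetric projective norm `π_s`. -/
def diagVec (n : ℕ) : Completion (SymmetricProjectiveTensor 𝕜 k (ellp 𝕜 p)) :=
  ((show SymmetricProjectiveTensor 𝕜 k (ellp 𝕜 p) from tensorPow 𝕜 k (unitVec 𝕜 p n)) :
    Completion (SymmetricProjectiveTensor 𝕜 k (ellp 𝕜 p)))

/-- The tensor diagonal `D_{k,p}` for the symmetric projective norm `π_s`: the closed span of the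
`e_n ⊗ ⋯ ⊗ e_n`. -/
def tensorDiagonal : Submodule 𝕜 (Completion (SymmetricProjectiveTensor 𝕜 k (ellp 𝕜 p))) :=
  (Submodule.span 𝕜 (Set.range (diagVec 𝕜 k p))).topologicalClosure

/-- `e_n ⊗ ⋯ ⊗ e_n` in the completion of the symmetric tensors over `ℓ_p` with respect to the
restriction of the projective norm `π` of the full tensor product. -/
def diagVecPi (n : ℕ) : Completion (symmetricTensors 𝕜 k (ellp 𝕜 p)) :=
  (tensorPow 𝕜 k (unitVec 𝕜 p n) : symmetricTensors 𝕜 k (ellp 𝕜 p))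

/-- The tensor diagonal for the restriction of the projective norm `π` of the full tensor
product: the closed span of the `e_n ⊗ ⋯ ⊗ e_n`. -/
def tensorDiagonalPi : Submodule 𝕜 (Completion (symmetricTensors 𝕜 k (ellp 𝕜 p))) :=
  (Submodule.span 𝕜 (Set.range (diagVecPi 𝕜 k p))).topologicalClosure

/-- If `k < p` then `1 ≤ p / k`, so that `ℓ_{p/k}` is a normed space. -/
theorem fact_one_le_div {k : ℕ} {p : ℝ≥0∞} (h : (k : ℝ≥0∞) < p) : Fact (1 ≤ p / k) :=
  ⟨by
    rw [ENNReal.le_div_iff_mul_le (Or.inr (pos_of_gt h).ne') (Or.inl (ENNReal.natCast_ne_top k)),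
      one_mul]
    exact h.le⟩

end Diagonal

end

/-! By density, it suffices to show that each finite sum of terms a_n e_n ⊗ ⋯ ⊗ e_n has the norm of
(a_n) in ℓ_q, where q = p/k if k < p and q = 1 if p ≤ k.

Lower bound: since p ≤ kq, Hölder makes the coordinatewise product ℓ_p × ⋯ × ℓ_p → ℓ_q a multilinear
contraction, so it linearizes to a contraction for π (`norm_sum_unitVec_le_norm_sum_tprod`). As π ≤
π_s, the bound passes to π_s.

Upper bound: for q = 1 it is the triangle inequality. For q = p/k, split a_n into k factors of
modulus |a_n|^(1/k), twist them by unimodular characters of a finite group, and average the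
resulting elementary tensors (`sum_multilinear_characters`). Off-diagonal terms cancel, and each
averaged tensor has norm at most the ℓ_{p/k} norm of (a_n). For π the slots may differ, so signs
suffice over either field. For π_s all slots must agree, which calls for kth roots of a_n and of
unity, hence complex scalars. -/

theorem unitVec_smul {𝕜 : Type*} [RCLike 𝕜] (p : ℝ≥0∞) (n : ℕ) (a : 𝕜) :
    a • unitVec 𝕜 p n = lp.single p n a := by
  rw [unitVec, ← lp.single_smul, smul_eq_mul, mul_one]

/-! ### Closed spans isometric to ℓ_q -/

/-- A sequence whose finite linear combinations have the norms of the corresponding elements of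
`ℓ_q` has closed span isometric to `ℓ_q`. -/
theorem exists_closedSpan_linearIsometryEquiv_ellp {𝕜 : Type*} [RCLike 𝕜] {E : Type*}
    [NormedAddCommGroup E] [NormedSpace 𝕜 E] [CompleteSpace E] (q : ℝ≥0∞) [Fact (1 ≤ q)]
    (hq : q ≠ ⊤) (v : ℕ → E)
    (h : ∀ (s : Finset ℕ) (a : ℕ → 𝕜),
      ‖∑ n ∈ s, a n • v n‖ = ‖∑ n ∈ s, a n • unitVec 𝕜 q n‖) :
    ∃ T : (Submodule.span 𝕜 (Set.range v)).topologicalClosure ≃ₗᵢ[𝕜] ellp 𝕜 q,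
      ∀ n : ℕ, (T.symm (unitVec 𝕜 q n)).1 = v n := by
  set D := (Submodule.span 𝕜 (Set.range v)).topologicalClosure
  have : CompleteSpace D :=
    (Submodule.isClosed_topologicalClosure _).completeSpace_coe
  have hle : Submodule.span 𝕜 (Set.range v) ≤ D := Submodule.le_topologicalClosure _
  let w : ℕ → D := fun n => ⟨v n, hle (Submodule.subset_span ⟨n, rfl⟩)⟩
  -- Finitely supported sequences map densely into both spaces with equal norms, so their identity
  -- map extends to the isometry.
  let e₁ : (ℕ →₀ 𝕜) →ₗ[𝕜] D := Finsupp.linearCombination 𝕜 w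
  let e₂ : (ℕ →₀ 𝕜) →ₗ[𝕜] ellp 𝕜 q := Finsupp.linearCombination 𝕜 (unitVec 𝕜 q)
  have hval : ∀ f, (e₁ f : E) = Finsupp.linearCombination 𝕜 v f := by
    intro f
    simp [e₁, w, Finsupp.linearCombination_apply, Finsupp.sum]
  have h₁ : DenseRange e₁ := by
    intro x
    rw [closure_subtype]
    have hx : (x : E) ∈ closure (Submodule.span 𝕜 (Set.range v) : Set E) := x.2
    refine closure_mono ?_ hx
    intro y hy
    rw [SetLike.mem_coe, Finsupp.mem_span_range_iff_exists_finsupp] at hy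
    obtain ⟨c, rfl⟩ := hy
    exact ⟨e₁ c, ⟨c, rfl⟩, hval c⟩
  have h₂ : DenseRange e₂ := by
    intro x
    refine mem_closure_of_tendsto (lp.hasSum_single hq x) (Filter.Eventually.of_forall fun s => ?_)
    refine ⟨∑ n ∈ s, Finsupp.single n (x n), ?_⟩
    simp [e₂, unitVec_smul]
  have hn : ∀ f, ‖e₂ (LinearEquiv.refl 𝕜 _ f)‖ = ‖e₁ f‖ := by
    intro f
    change ‖e₂ f‖ = ‖(e₁ f : E)‖
    rw [hval]
    exact (h f.support f).symm
  refine ⟨(LinearEquiv.refl 𝕜 _).extendOfIsometry e₁ e₂ h₁ h₂ hn, fun n => ?_⟩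
  have := LinearEquiv.extendOfIsometry_symm_eq (LinearEquiv.refl 𝕜 _) e₁ e₂ h₁ h₂ hn
    (Finsupp.single n 1)
  rw [show e₂ (Finsupp.single n 1) = unitVec 𝕜 q n by simp [e₂]] at this
  rw [this]
  simp [e₁, w]

/-! ### Lower bound: Hölder and the diagonal map -/

theorem sum_norm_rpow_le {𝕜 : Type*} [RCLike 𝕜] {p : ℝ≥0∞} [Fact (1 ≤ p)] (hp : p ≠ ⊤)
    (x : ellp 𝕜 p) (s : Finset ℕ) :
    ∑ n ∈ s, (‖x n‖ / ‖x‖) ^ p.toReal ≤ 1 := by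
  have hp0 : 0 < p.toReal := ENNReal.toReal_pos (zero_lt_one.trans_le Fact.out).ne' hp
  simp_rw [Real.div_rpow (norm_nonneg _) (norm_nonneg _)]
  rw [← Finset.sum_div]
  exact div_le_one_of_le₀ (lp.sum_rpow_le_norm_rpow hp0 x s) (by positivity)

/-- Hölder's inequality for products of `k` sequences in `ℓ_p`. -/
theorem sum_prod_norm_rpow_le {𝕜 : Type*} [RCLike 𝕜] {p : ℝ≥0∞} [Fact (1 ≤ p)] (hp : p ≠ ⊤)
    {k : ℕ} (hk : 1 ≤ k) {q : ℝ} (hpq : p.toReal ≤ k * q) (x : Fin k → ellp 𝕜 p)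
    (s : Finset ℕ) :
    ∑ n ∈ s, (∏ i, ‖x i n‖) ^ q ≤ (∏ i, ‖x i‖) ^ q := by
  have hk0 : (0 : ℝ) < k := by exact_mod_cast hk
  have hp0 : p ≠ 0 := (zero_lt_one.trans_le Fact.out).ne'
  set y : Fin k → ℕ → ℝ := fun i n => ‖x i n‖ / ‖x i‖ with hy
  have hy0 : ∀ i n, 0 ≤ y i n := fun i n => by positivity
  have hy1 : ∀ i n, y i n ≤ 1 := fun i n =>
    div_le_one_of_le₀ (lp.norm_apply_le_norm hp0 _ _) (norm_nonneg _)
  have hxy : ∀ i n, ‖x i n‖ = ‖x i‖ * y i n := by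
    intro i n
    rcases eq_or_ne ‖x i‖ 0 with h0 | h0
    · have := lp.norm_apply_le_norm hp0 (x i) n
      rw [h0] at this ⊢
      rw [zero_mul]
      exact le_antisymm this (norm_nonneg _)
    · rw [hy]
      field_simp
  -- AM-GM with weights 1/k bounds the product by the mean of y^(kq). As 0 ≤ y ≤ 1 and p ≤ kq, the
  -- exponent may be lowered to p.
  have key : ∀ n, (∏ i, y i n) ^ q ≤ ∑ i, (k : ℝ)⁻¹ * y i n ^ p.toReal := by
    intro n
    have h1 := Real.geom_mean_le_arith_mean_weighted Finset.univ (fun _ : Fin k => (k : ℝ)⁻¹)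
      (fun i => y i n ^ (k * q)) (fun _ _ => by positivity)
      (by simp [hk0.ne']) (fun i _ => Real.rpow_nonneg (hy0 i n) _)
    have h2 : (∏ i, y i n) ^ q = ∏ i, (y i n ^ (k * q)) ^ (k : ℝ)⁻¹ := by
      rw [← Real.finsetProd_rpow _ _ fun i _ => hy0 i n]
      refine Finset.prod_congr rfl fun i _ => ?_
      rw [← Real.rpow_mul (hy0 i n)]
      congr 1
      field_simp
    rw [h2]
    refine h1.trans (Finset.sum_le_sum fun i _ => ?_)
    refine mul_le_mul_of_nonneg_left ?_ (by positivity)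
    exact Real.rpow_le_rpow_of_exponent_ge' (hy0 i n) (hy1 i n) ENNReal.toReal_nonneg hpq
  calc ∑ n ∈ s, (∏ i, ‖x i n‖) ^ q
      = (∏ i, ‖x i‖) ^ q * ∑ n ∈ s, (∏ i, y i n) ^ q := by
        rw [Finset.mul_sum]
        refine Finset.sum_congr rfl fun n _ => ?_
        rw [← Real.mul_rpow (Finset.prod_nonneg fun _ _ => norm_nonneg _)
          (Finset.prod_nonneg fun i _ => hy0 i n), ← Finset.prod_mul_distrib]
        simp_rw [hxy]
    _ ≤ (∏ i, ‖x i‖) ^ q * 1 := by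
        refine mul_le_mul_of_nonneg_left ?_ (by positivity)
        calc ∑ n ∈ s, (∏ i, y i n) ^ q
            ≤ ∑ n ∈ s, ∑ i, (k : ℝ)⁻¹ * y i n ^ p.toReal := Finset.sum_le_sum fun n _ => key n
          _ = ∑ i, (k : ℝ)⁻¹ * ∑ n ∈ s, y i n ^ p.toReal := by
              rw [Finset.sum_comm]
              simp_rw [Finset.mul_sum]
          _ ≤ ∑ i : Fin k, (k : ℝ)⁻¹ * 1 := by
              refine Finset.sum_le_sum fun i _ => ?_
              exact mul_le_mul_of_nonneg_left (sum_norm_rpow_le hp (x i) s) (by positivity)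
          _ = 1 := by simp [hk0.ne']
    _ = _ := mul_one _

/-- The multilinear map `(x₁, …, x_k) ↦ ∑ n ∈ s, x₁(n) ⋯ x_k(n) e_n`. -/
noncomputable def diagonalMap (𝕜 : Type*) [RCLike 𝕜] (p q : ℝ≥0∞) (k : ℕ) (s : Finset ℕ) :
    MultilinearMap 𝕜 (fun _ : Fin k => ellp 𝕜 p) (ellp 𝕜 q) :=
  ∑ n ∈ s, (lp.lsingle (𝕜 := 𝕜) (E := fun _ : ℕ => 𝕜) q n).compMultilinearMap
    ((MultilinearMap.mkPiAlgebra 𝕜 (Fin k) 𝕜).compLinearMap fun _ => lp.evalₗ (𝕜 := 𝕜) (fun _ : ℕ => 𝕜) p n)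

theorem diagonalMap_apply {𝕜 : Type*} [RCLike 𝕜] {p q : ℝ≥0∞} {k : ℕ} (s : Finset ℕ)
    (x : Fin k → ellp 𝕜 p) :
    diagonalMap 𝕜 p q k s x = ∑ n ∈ s, lp.single q n (∏ i, x i n) := by
  simp [diagonalMap]

theorem norm_diagonalMap_le {𝕜 : Type*} [RCLike 𝕜] {p q : ℝ≥0∞} [Fact (1 ≤ p)] [Fact (1 ≤ q)]
    (hp : p ≠ ⊤) (hq : q ≠ ⊤) {k : ℕ} (hk : 1 ≤ k) (hpq : p.toReal ≤ k * q.toReal)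
    (s : Finset ℕ) (x : Fin k → ellp 𝕜 p) :
    ‖diagonalMap 𝕜 p q k s x‖ ≤ 1 * ∏ i, ‖x i‖ := by
  have hq0 : 0 < q.toReal := ENNReal.toReal_pos (zero_lt_one.trans_le Fact.out).ne' hq
  rw [one_mul, ← Real.rpow_le_rpow_iff (norm_nonneg _) (by positivity) hq0, diagonalMap_apply,
    lp.norm_sum_single hq0]
  simp_rw [norm_prod]
  exact sum_prod_norm_rpow_le hp hk hpq x s

/-- The projective norm of a diagonal tensor dominates its norm in `ℓ_q`. -/
theorem norm_sum_unitVec_le_norm_sum_tprod {𝕜 : Type*} [RCLike 𝕜] {p q : ℝ≥0∞} [Fact (1 ≤ p)]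
    [Fact (1 ≤ q)] (hp : p ≠ ⊤) (hq : q ≠ ⊤) {k : ℕ} (hk : 1 ≤ k)
    (hpq : p.toReal ≤ k * q.toReal) (s : Finset ℕ) (a : ℕ → 𝕜) :
    ‖∑ n ∈ s, a n • unitVec 𝕜 q n‖ ≤
      ‖∑ n ∈ s, a n • PiTensorProduct.tprod 𝕜 fun _ : Fin k => unitVec 𝕜 p n‖ := by
  let f := (diagonalMap 𝕜 p q k s).mkContinuous 1 (norm_diagonalMap_le hp hq hk hpq s)
  have hf : ‖f‖ ≤ 1 := MultilinearMap.mkContinuous_norm_le _ zero_le_one _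
  have h := PiTensorProduct.norm_eval_le_projectiveSeminorm f
    (∑ n ∈ s, a n • PiTensorProduct.tprod 𝕜 fun _ : Fin k => unitVec 𝕜 p n)
  refine le_trans (le_of_eq ?_) (h.trans (mul_le_of_le_one_left (norm_nonneg _) hf))
  rw [map_sum]
  congr 1
  refine Finset.sum_congr rfl fun n hn => ?_
  rw [map_smul, PiTensorProduct.lift.tprod]
  congr 1
  change _ = diagonalMap 𝕜 p q k s _
  rw [diagonalMap_apply, Finset.sum_eq_single n]
  · simp [unitVec]
  · intro m _ hm
    -- An empty product would be 1, and the terms with m ≠ n would survive.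
    have : k ≠ 0 := by omega
    simp [unitVec, lp.single_apply, hm, this]
  · exact fun h => absurd hn h

/-! ### Norms of finite sums of unit vectors -/

theorem norm_unitVec {𝕜 : Type*} [RCLike 𝕜] (p : ℝ≥0∞) [Fact (1 ≤ p)] (n : ℕ) :
    ‖unitVec 𝕜 p n‖ = 1 := by
  rw [unitVec, lp.norm_single (zero_lt_one.trans_le Fact.out), norm_one]

theorem norm_sum_unitVec_one {𝕜 : Type*} [RCLike 𝕜] (s : Finset ℕ) (a : ℕ → 𝕜) :
    ‖∑ n ∈ s, a n • unitVec 𝕜 1 n‖ = ∑ n ∈ s, ‖a n‖ := by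
  have := lp.norm_sum_single (p := 1) (by simp) a s
  simpa [unitVec_smul] using this

theorem norm_sum_coe_unitVec_rpow {𝕜 : Type*} [RCLike 𝕜] {p : ℝ≥0∞} (hp : 0 < p.toReal)
    (s : Finset ℕ) (c : s → 𝕜) :
    ‖∑ n : s, c n • unitVec 𝕜 p n‖ ^ p.toReal = ∑ n : s, ‖c n‖ ^ p.toReal := by
  let d : ℕ → 𝕜 := fun n => if h : n ∈ s then c ⟨n, h⟩ else 0
  have hd : ∀ n : s, c n = d n := fun n => by simp [d]
  simp_rw [hd, unitVec_smul]
  rw [Finset.sum_coe_sort s fun n => lp.single p n (d n),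
    Finset.sum_coe_sort s fun n => ‖d n‖ ^ p.toReal]
  exact lp.norm_sum_single hp d s

/-- Only the moduli of the coefficients enter, so every unimodular twist of the kth roots has the
same norm; this makes all terms of the averages equally large. -/
theorem norm_sum_root_unitVec_pow {𝕜 : Type*} [RCLike 𝕜] {k : ℕ} (hk : 1 ≤ k) {p : ℝ≥0∞}
    [Fact (1 ≤ p)] (hp : p ≠ ⊤) [Fact (1 ≤ p / k)] (s : Finset ℕ) (a : ℕ → 𝕜) (c : s → 𝕜)
    (hc : ∀ n, ‖c n‖ = ‖a n‖ ^ (k : ℝ)⁻¹) :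
    ‖∑ n : s, c n • unitVec 𝕜 p n‖ ^ k = ‖∑ n ∈ s, a n • unitVec 𝕜 (p / k) n‖ := by
  have hk0 : (0 : ℝ) < k := by exact_mod_cast hk
  have hp0 : 0 < p.toReal := ENNReal.toReal_pos (zero_lt_one.trans_le Fact.out).ne' hp
  have hr : (p / k).toReal = p.toReal / k := by simp [ENNReal.toReal_div]
  have hr0 : 0 < (p / k).toReal := by rw [hr]; positivity
  rw [← Real.rpow_left_inj (by positivity) (norm_nonneg _) hr0.ne']
  simp_rw [unitVec_smul (p / k)]
  rw [lp.norm_sum_single hr0, ← Real.rpow_natCast, ← Real.rpow_mul (norm_nonneg _), hr,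
    mul_div_cancel₀ _ hk0.ne', norm_sum_coe_unitVec_rpow hp0,
    ← Finset.sum_coe_sort s fun n => ‖a n‖ ^ (p.toReal / k)]
  refine Finset.sum_congr rfl fun n _ => ?_
  rw [hc, ← Real.rpow_mul (norm_nonneg _), inv_mul_eq_div]

/-! ### Polarization and the two families of characters -/

/-- Polarization over a finite group of characters that are orthogonal off the diagonal. -/
theorem sum_multilinear_characters {𝕜 X F ι G : Type*} [Field 𝕜] [AddCommGroup X] [Module 𝕜 X]
    [AddCommGroup F] [Module 𝕜 F] [Fintype ι] [Group G] [Fintype G] {k : ℕ} (hk : 1 ≤ k)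
    (f : MultilinearMap 𝕜 (fun _ : Fin k => X) F) (χ : Fin k → ι → G →* 𝕜)
    (hχ : ∀ r : Fin k → ι, ∏ i, χ i (r i) = 1 ↔ ∀ i j, r i = r j) (c : Fin k → ι → 𝕜)
    (e : ι → X) :
    ∑ g, f (fun i => ∑ n, (χ i n g * c i n) • e n) =
      (Fintype.card G : 𝕜) • ∑ n, (∏ i, c i n) • f fun _ => e n := by
  classical
  simp_rw [MultilinearMap.map_sum, MultilinearMap.map_smul_univ, Finset.prod_mul_distrib]
  rw [Finset.sum_comm]
  have h : ∀ r : Fin k → ι, ∑ g, ((∏ i, χ i (r i) g) * ∏ i, c i (r i)) • f (fun i => e (r i)) =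
      (if ∀ i j, r i = r j then (Fintype.card G : 𝕜) else 0) •
        (∏ i, c i (r i)) • f (fun i => e (r i)) := by
    intro r
    -- A character sums to the order of the group if trivial and to zero otherwise.
    have h1 := sum_hom_units (∏ i, χ i (r i))
    simp only [MonoidHom.finsetProd_apply, hχ] at h1
    rw [← Finset.sum_smul, ← Finset.sum_mul, h1, mul_smul]
    push_cast
    rfl
  simp_rw [h, ite_smul, zero_smul]
  rw [← Finset.sum_filter, ← Finset.smul_sum]
  congr 1
  refine Finset.sum_bij' (fun r _ => r ⟨0, hk⟩) (fun n _ _ => n) ?_ ?_ ?_ ?_ ?_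
  · simp
  · simp
  · intro r hr
    funext i
    exact (Finset.mem_filter.1 hr).2 _ _
  · simp
  · intro r hr
    have hr' : r = fun _ => r ⟨0, hk⟩ := funext fun i => (Finset.mem_filter.1 hr).2 _ _
    rw [hr']

/-- The character `ε ↦ ε_i(n) ε_{i+1}(n)` of the group of `k`-tuples of sign sequences. -/
def signCharacter (R : Type*) [Ring R] {ι : Type*} {m : ℕ} (i : Fin (m + 1)) (n : ι) :
    (Fin (m + 1) → ι → ℤˣ) →* R :=
  (Int.castRingHom R : ℤ →* R).comp <| (Units.coeHom ℤ).comp <|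
    (Pi.evalMonoidHom (fun _ : ι => ℤˣ) n).comp (Pi.evalMonoidHom _ i) *
      (Pi.evalMonoidHom (fun _ : ι => ℤˣ) n).comp (Pi.evalMonoidHom _ (i + 1))

theorem signCharacter_apply {R : Type*} [Ring R] {ι : Type*} {m : ℕ} (i : Fin (m + 1)) (n : ι)
    (ε : Fin (m + 1) → ι → ℤˣ) :
    signCharacter R i n ε = ((ε i n * ε (i + 1) n : ℤˣ) : ℤ) := rfl

theorem norm_signCharacter {𝕜 : Type*} [RCLike 𝕜] {ι : Type*} {m : ℕ} (i : Fin (m + 1)) (n : ι)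
    (ε : Fin (m + 1) → ι → ℤˣ) : ‖signCharacter 𝕜 i n ε‖ = 1 := by
  rw [signCharacter_apply]
  rcases Int.units_eq_one_or (ε i n * ε (i + 1) n) with h | h <;> simp [h]

theorem prod_signCharacter_eq_one_iff {R : Type*} [CommRing R] [CharZero R] {ι : Type*} {m : ℕ}
    (r : Fin (m + 1) → ι) :
    ∏ i, signCharacter R i (r i) = 1 ↔ ∀ i j, r i = r j := by
  classical
  have happ : ∀ ε, (∏ i, signCharacter R i (r i)) ε =
      (((∏ i, ε i (r i)) * ∏ i, ε (i + 1) (r i) : ℤˣ) : ℤ) := by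
    intro ε
    rw [MonoidHom.finsetProd_apply, ← Finset.prod_mul_distrib]
    simp_rw [signCharacter_apply]
    push_cast
    rfl
  constructor
  · intro h
    have hstep : ∀ i, r (i + 1) = r i := by
      intro i
      by_contra hne
      -- Flip the single sign ε_{i+1}(r i). The first product does not see it because r (i+1) ≠ r i;
      -- the second sees it exactly once, at index i, so the character takes the value -1.
      have h1 := happ (Pi.mulSingle (i + 1) (Pi.mulSingle (r i) (-1)))
      rw [h, MonoidHom.one_apply, Finset.prod_eq_one, Finset.prod_eq_single i] at h1
      · simp at h1
        norm_num [eq_neg_iff_add_eq_zero] at h1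
      · intro j _ hj
        rw [Pi.mulSingle_eq_of_ne (by simpa using hj), Pi.one_apply]
      · simp
      · intro j _
        rcases eq_or_ne j (i + 1) with rfl | hj
        · rw [Pi.mulSingle_eq_same, Pi.mulSingle_eq_of_ne hne]
        · rw [Pi.mulSingle_eq_of_ne hj, Pi.one_apply]
    have h0 : ∀ i, r i = r 0 := by
      intro i
      induction i using Fin.induction with
      | zero => rfl
      | succ i ih => rw [← Fin.coeSucc_eq_succ, hstep, ih]
    exact fun i j => (h0 i).trans (h0 j).symm
  · intro h
    refine MonoidHom.ext fun ε => ?_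
    rw [happ]
    -- For constant r the two products differ by a cyclic shift of the slots, so the value is the
    -- square of a sign.
    have h2 : ∏ i, ε (i + 1) (r i) = ∏ i, ε i (r i) := by
      rw [← Equiv.prod_comp (Equiv.addRight (1 : Fin (m + 1))) fun i => ε i (r i)]
      exact Finset.prod_congr rfl fun i _ => by rw [h i (i + 1)]; rfl
    rw [h2, Int.units_mul_self]
    simp

/-- The coordinate character of the group of sequences of roots of unity. -/
noncomputable def rootCharacter {ι : Type*} (k : ℕ) (n : ι) : (ι → rootsOfUnity k ℂ) →* ℂ :=
  (Units.coeHom ℂ).comp <| (rootsOfUnity k ℂ).subtype.comp <|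
    Pi.evalMonoidHom (fun _ : ι => rootsOfUnity k ℂ) n

theorem rootCharacter_apply {ι : Type*} {k : ℕ} (n : ι) (ε : ι → rootsOfUnity k ℂ) :
    rootCharacter k n ε = ((ε n : ℂˣ) : ℂ) := rfl

theorem norm_rootCharacter {ι : Type*} {k : ℕ} (hk : 1 ≤ k) (n : ι)
    (ε : ι → rootsOfUnity k ℂ) : ‖rootCharacter k n ε‖ = 1 := by
  rw [rootCharacter_apply]
  have : ((ε n : ℂˣ) : ℂ) ^ k = 1 := by
    have := (mem_rootsOfUnity' k _).1 (ε n).2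
    simpa using this
  exact Complex.norm_eq_one_of_pow_eq_one this (by omega)

theorem prod_rootCharacter_eq_one_iff {ι : Type*} {k : ℕ} (hk : 1 ≤ k) (r : Fin k → ι) :
    ∏ i, rootCharacter k (r i) = 1 ↔ ∀ i j, r i = r j := by
  classical
  have happ : ∀ ε, (∏ i, rootCharacter k (r i)) ε = ((∏ i, ε (r i) : rootsOfUnity k ℂ) : ℂˣ) := by
    intro ε
    rw [MonoidHom.finsetProd_apply]
    simp_rw [rootCharacter_apply]
    push_cast
    rfl
  constructor
  · intro h
    have : NeZero k := ⟨by omega⟩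
    have hζ := Complex.isPrimitiveRoot_exp k (by omega)
    set ζ : rootsOfUnity k ℂ := hζ.toRootsOfUnity with hζdef
    have h0 : ∀ j, ∀ i, r i = r j := by
      intro j
      -- Testing with ζ at r j and 1 elsewhere gives ζ to the number of i with r i = r j.
      -- Primitivity makes this number a multiple of k; it lies between 1 and k, so it is k.
      have h1 := happ (Pi.mulSingle (r j) ζ)
      have h2 : ∏ i, (Pi.mulSingle (r j) ζ : ι → rootsOfUnity k ℂ) (r i) =
          ζ ^ (Finset.univ.filter fun i => r i = r j).card := by
        simp_rw [Pi.mulSingle_apply]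
        rw [Finset.prod_ite, Finset.prod_const, Finset.prod_const_one, mul_one]
      rw [h, h2, MonoidHom.one_apply] at h1
      have h3 : k ∣ (Finset.univ.filter fun i => r i = r j).card := by
        apply hζ.dvd_of_pow_eq_one
        rw [h1]
        simp [hζdef]
      have h4 : 0 < (Finset.univ.filter fun i => r i = r j).card :=
        Finset.card_pos.2 ⟨j, by simp⟩
      have h5 : (Finset.univ.filter fun i => r i = r j) = Finset.univ := by
        apply Finset.eq_univ_of_card
        refine le_antisymm (Finset.card_le_univ _) ?_
        simpa using Nat.le_of_dvd h4 h3
      intro i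
      have := Finset.mem_univ i
      rw [← h5] at this
      exact (Finset.mem_filter.1 this).2
    exact fun i j => h0 j i
  · intro h
    refine MonoidHom.ext fun ε => ?_
    rw [happ]
    have h2 : ∏ i, ε (r i) = 1 := by
      rw [Finset.prod_congr rfl fun i _ => by rw [h i ⟨0, hk⟩], Finset.prod_const,
        Finset.card_univ, Fintype.card_fin]
      exact Subtype.ext (ε (r ⟨0, hk⟩)).2
    rw [h2]
    simp

/-! ### Upper bound for the projective norm -/

/-- Replaces kth roots, which real scalars may lack: one factor carries the phase a/|a|, the others
are positive unless a = 0. -/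
theorem exists_prod_eq_norm_eq_rpow {𝕜 : Type*} [RCLike 𝕜] (m : ℕ) (a : 𝕜) :
    ∃ c : Fin (m + 1) → 𝕜, ∏ i, c i = a ∧ ∀ i, ‖c i‖ = ‖a‖ ^ ((m + 1 : ℕ) : ℝ)⁻¹ := by
  set t : ℝ := ‖a‖ ^ ((m + 1 : ℕ) : ℝ)⁻¹ with ht
  have ht0 : 0 ≤ t := by positivity
  have htk : t ^ (m + 1) = ‖a‖ := Real.rpow_inv_natCast_pow (norm_nonneg a) (by omega)
  rcases eq_or_ne a 0 with rfl | ha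
  · have : t = 0 := by rw [norm_zero] at htk; exact pow_eq_zero_iff (by omega) |>.1 htk
    exact ⟨0, by simp, by simp [this]⟩
  have hna : (‖a‖ : 𝕜) ≠ 0 := by simpa using ha
  refine ⟨Fin.cons (a / ‖a‖ * t) fun _ => t, ?_, fun i => ?_⟩
  · rw [Fin.prod_univ_succ]
    simp only [Fin.cons_zero, Fin.cons_succ, Finset.prod_const, Finset.card_univ,
      Fintype.card_fin]
    rw [mul_assoc, ← pow_succ', ← RCLike.ofReal_pow, htk, div_mul_cancel₀ _ hna]
  · refine Fin.cases ?_ (fun j => ?_) i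
    · have : ‖a‖ ≠ 0 := by simpa using ha
      simp [this, abs_of_nonneg ht0]
    · simp [abs_of_nonneg ht0]

theorem norm_le_of_card_smul_eq_sum {𝕜 F G : Type*} [RCLike 𝕜] [SeminormedAddCommGroup F]
    [NormedSpace 𝕜 F] [Fintype G] [Nonempty G] {u : F} {w : G → F} {C : ℝ}
    (h : ∑ g, w g = (Fintype.card G : 𝕜) • u) (hw : ∀ g, ‖w g‖ ≤ C) : ‖u‖ ≤ C := by
  have hc : (0 : ℝ) < Fintype.card G := by exact_mod_cast Fintype.card_pos
  have h1 : ‖(Fintype.card G : 𝕜) • u‖ ≤ Fintype.card G * C := by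
    rw [← h]
    refine (norm_sum_le_of_le _ fun g _ => hw g).trans (le_of_eq ?_)
    simp
  rw [norm_smul, RCLike.norm_natCast] at h1
  exact le_of_mul_le_mul_left h1 hc

theorem norm_sum_tprod_le_of_lt {𝕜 : Type*} [RCLike 𝕜] {k : ℕ} (hk : 1 ≤ k) {p : ℝ≥0∞}
    [Fact (1 ≤ p)] (hp : p ≠ ⊤) [Fact (1 ≤ p / k)] (s : Finset ℕ) (a : ℕ → 𝕜) :
    ‖∑ n ∈ s, a n • PiTensorProduct.tprod 𝕜 fun _ : Fin k => unitVec 𝕜 p n‖ ≤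
      ‖∑ n ∈ s, a n • unitVec 𝕜 (p / k) n‖ := by
  obtain ⟨m, rfl⟩ : ∃ m, k = m + 1 := ⟨k - 1, by omega⟩
  choose c hprod hnorm using fun n : s => exists_prod_eq_norm_eq_rpow m (a n)
  have h := sum_multilinear_characters hk (PiTensorProduct.tprod 𝕜)
    (fun i (n : s) => signCharacter 𝕜 i n) prod_signCharacter_eq_one_iff (fun i n => c n i)
    (fun n : s => unitVec 𝕜 p n)
  simp_rw [hprod] at h
  rw [← Finset.sum_coe_sort s fun n =>
    a n • PiTensorProduct.tprod 𝕜 fun _ : Fin (m + 1) => unitVec 𝕜 p n]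
  refine norm_le_of_card_smul_eq_sum h fun ε =>
    (PiTensorProduct.projectiveSeminorm_tprod_le _).trans (le_of_eq ?_)
  have h1 : ∀ i, ‖∑ n : s, (signCharacter 𝕜 i n ε * c n i) • unitVec 𝕜 p n‖ ^ (m + 1) =
      ‖∑ n ∈ s, a n • unitVec 𝕜 (p / (m + 1 : ℕ)) n‖ := fun i =>
    norm_sum_root_unitVec_pow hk hp s a _ fun n => by
      rw [norm_mul, norm_signCharacter, one_mul, hnorm]
  -- The k factors differ, but their norms have equal kth powers; hence the norms agree and their
  -- product is that kth power.
  have h2 : ∀ i, ‖∑ n : s, (signCharacter 𝕜 i n ε * c n i) • unitVec 𝕜 p n‖ =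
      ‖∑ n : s, (signCharacter 𝕜 0 n ε * c n 0) • unitVec 𝕜 p n‖ := fun i =>
    (pow_left_inj₀ (norm_nonneg _) (norm_nonneg _) (by omega)).1 ((h1 i).trans (h1 0).symm)
  rw [Finset.prod_congr rfl fun i _ => h2 i, Finset.prod_const, Finset.card_univ,
    Fintype.card_fin, h1]

theorem norm_sum_tprod_le_sum {𝕜 : Type*} [RCLike 𝕜] {p : ℝ≥0∞} [Fact (1 ≤ p)] (k : ℕ)
    (s : Finset ℕ) (a : ℕ → 𝕜) :
    ‖∑ n ∈ s, a n • PiTensorProduct.tprod 𝕜 fun _ : Fin k => unitVec 𝕜 p n‖ ≤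
      ∑ n ∈ s, ‖a n‖ := by
  refine norm_sum_le_of_le _ fun n _ => ?_
  rw [norm_smul]
  refine mul_le_of_le_one_right (norm_nonneg _)
    ((PiTensorProduct.projectiveSeminorm_tprod_le _).trans (le_of_eq ?_))
  simp [norm_unitVec]

/-! ### Upper and lower bounds for the symmetric projective norm -/

section SymmetricProjectiveNorm

variable {𝕜 : Type*} [RCLike 𝕜] {k : ℕ} {X : Type*} [NormedAddCommGroup X] [NormedSpace 𝕜 X]

/-- The tensor `x ⊗ ⋯ ⊗ x` in the symmetric projective tensor power. -/
def symmetricTensorPow (𝕜 : Type*) [RCLike 𝕜] (k : ℕ) {X : Type*} [NormedAddCommGroup X]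
    [NormedSpace 𝕜 X] (x : X) : SymmetricProjectiveTensor 𝕜 k X :=
  tensorPow 𝕜 k x

/-- The inclusion of the symmetric projective tensor power into the projective tensor power. -/
def symmetricInclusion (𝕜 : Type*) [RCLike 𝕜] (k : ℕ) (X : Type*) [NormedAddCommGroup X]
    [NormedSpace 𝕜 X] : SymmetricProjectiveTensor 𝕜 k X →ₗ[𝕜] ⨂[𝕜] _ : Fin k, X :=
  (symmetricTensors 𝕜 k X).subtype

theorem symmetricInclusion_injective : Function.Injective (symmetricInclusion 𝕜 k X) :=
  Subtype.val_injective

@[simp]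
theorem symmetricInclusion_symmetricTensorPow (x : X) :
    symmetricInclusion 𝕜 k X (symmetricTensorPow 𝕜 k x) =
      PiTensorProduct.tprod 𝕜 fun _ : Fin k => x := rfl

theorem SymmetricProjectiveTensor.norm_def (u : SymmetricProjectiveTensor 𝕜 k X) :
    ‖u‖ = sInf (symmetricCosts 𝕜 k (show symmetricTensors 𝕜 k X from u)) := rfl

theorem norm_symmetricTensorPow_le (x : X) : ‖symmetricTensorPow 𝕜 k x‖ ≤ ‖x‖ ^ k := by
  rw [SymmetricProjectiveTensor.norm_def]
  refine csInf_le (symmetricCosts_bddBelow 𝕜 k X _) ⟨1, fun _ => 1, fun _ => x, ?_, ?_⟩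
  · simp
    rfl
  · simp

/-- Every representation competing for π_s is also a representation by elementary tensors, at the
same cost. -/
theorem norm_symmetricInclusion_le (u : SymmetricProjectiveTensor 𝕜 k X) :
    ‖symmetricInclusion 𝕜 k X u‖ ≤ ‖u‖ := by
  rw [SymmetricProjectiveTensor.norm_def]
  refine le_csInf (symmetricCosts_nonempty 𝕜 k X _) ?_
  rintro _ ⟨n, c, x, hu, rfl⟩
  have h : symmetricInclusion 𝕜 k X u =
      ∑ j, c j • PiTensorProduct.tprod 𝕜 fun _ : Fin k => x j := by
    have := congrArg (symmetricTensors 𝕜 k X).subtype hu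
    rw [map_sum] at this
    exact this
  rw [h]
  refine norm_sum_le_of_le _ fun j _ => ?_
  rw [norm_smul]
  refine mul_le_mul_of_nonneg_left
    ((PiTensorProduct.projectiveSeminorm_tprod_le _).trans (le_of_eq ?_)) (norm_nonneg _)
  simp

end SymmetricProjectiveNorm

theorem norm_sum_symmetricTensorPow_le_of_lt {k : ℕ} (hk : 1 ≤ k) {p : ℝ≥0∞} [Fact (1 ≤ p)]
    (hp : p ≠ ⊤) [Fact (1 ≤ p / k)] (s : Finset ℕ) (a : ℕ → ℂ) :
    ‖∑ n ∈ s, a n • symmetricTensorPow ℂ k (unitVec ℂ p n)‖ ≤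
      ‖∑ n ∈ s, a n • unitVec ℂ (p / k) n‖ := by
  have : NeZero k := ⟨by omega⟩
  have : Fintype (rootsOfUnity k ℂ) := Fintype.ofFinite _
  set c : ℕ → ℂ := fun n => a n ^ (k : ℂ)⁻¹ with hcdef
  have hc : ∀ n, c n ^ k = a n := fun n => Complex.cpow_nat_inv_pow _ (by omega)
  have hnorm : ∀ n, ‖c n‖ = ‖a n‖ ^ (k : ℝ)⁻¹ := fun n => by
    rw [← hc n, norm_pow, Real.pow_rpow_inv_natCast (norm_nonneg _) (by omega)]
  have h := sum_multilinear_characters hk (PiTensorProduct.tprod ℂ)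
    (fun _ (n : s) => rootCharacter k n) (prod_rootCharacter_eq_one_iff hk) (fun _ n => c n)
    (fun n : s => unitVec ℂ p n)
  have h' : ∑ ε : s → rootsOfUnity k ℂ,
      symmetricTensorPow ℂ k (∑ n : s, (rootCharacter k n ε * c n) • unitVec ℂ p n) =
      (Fintype.card (s → rootsOfUnity k ℂ) : ℂ) •
        ∑ n : s, a n • symmetricTensorPow ℂ k (unitVec ℂ p n) := by
    -- The averaging identity lives in the full tensor power. Both sides are symmetric, because
    -- every slot carries the same character and root, so it can be pulled back.
    apply symmetricInclusion_injective
    simp only [map_sum, map_smul, symmetricInclusion_symmetricTensorPow]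
    rw [h]
    simp [hc]
  rw [← Finset.sum_coe_sort s fun n => a n • symmetricTensorPow ℂ k (unitVec ℂ p n)]
  refine norm_le_of_card_smul_eq_sum h' fun ε =>
    (norm_symmetricTensorPow_le _).trans (le_of_eq ?_)
  exact norm_sum_root_unitVec_pow hk hp s a _ fun n => by
    rw [norm_mul, norm_rootCharacter hk, one_mul, hnorm]

theorem norm_sum_symmetricTensorPow_le_sum {𝕜 : Type*} [RCLike 𝕜] {p : ℝ≥0∞} [Fact (1 ≤ p)]
    (k : ℕ) (s : Finset ℕ) (a : ℕ → 𝕜) :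
    ‖∑ n ∈ s, a n • symmetricTensorPow 𝕜 k (unitVec 𝕜 p n)‖ ≤ ∑ n ∈ s, ‖a n‖ := by
  refine norm_sum_le_of_le _ fun n _ => ?_
  rw [norm_smul]
  refine mul_le_of_le_one_right (norm_nonneg _) ((norm_symmetricTensorPow_le _).trans ?_)
  simp [norm_unitVec]

theorem norm_sum_unitVec_le_norm_sum_symmetricTensorPow {𝕜 : Type*} [RCLike 𝕜] {p q : ℝ≥0∞}
    [Fact (1 ≤ p)] [Fact (1 ≤ q)] (hp : p ≠ ⊤) (hq : q ≠ ⊤) {k : ℕ} (hk : 1 ≤ k)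
    (hpq : p.toReal ≤ k * q.toReal) (s : Finset ℕ) (a : ℕ → 𝕜) :
    ‖∑ n ∈ s, a n • unitVec 𝕜 q n‖ ≤
      ‖∑ n ∈ s, a n • symmetricTensorPow 𝕜 k (unitVec 𝕜 p n)‖ := by
  refine le_trans ?_ (norm_symmetricInclusion_le _)
  simp only [map_sum, map_smul, symmetricInclusion_symmetricTensorPow]
  exact norm_sum_unitVec_le_norm_sum_tprod hp hq hk hpq s a

/-! ### Passage to the completions and conclusion -/

theorem norm_sum_diagVec {𝕜 : Type*} [RCLike 𝕜] (k : ℕ) (p : ℝ≥0∞) [Fact (1 ≤ p)]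
    (s : Finset ℕ) (a : ℕ → 𝕜) :
    ‖∑ n ∈ s, a n • diagVec 𝕜 k p n‖ =
      ‖∑ n ∈ s, a n • symmetricTensorPow 𝕜 k (unitVec 𝕜 p n)‖ := by
  have h1 : ∑ n ∈ s, a n • diagVec 𝕜 k p n =
      ((∑ n ∈ s, a n • symmetricTensorPow 𝕜 k (unitVec 𝕜 p n) :
        SymmetricProjectiveTensor 𝕜 k (ellp 𝕜 p)) :
        Completion (SymmetricProjectiveTensor 𝕜 k (ellp 𝕜 p))) := by
    change _ = Completion.toComplL (𝕜 := 𝕜) _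
    rw [map_sum]
    simp_rw [map_smul]
    rfl
  rw [h1, Completion.norm_coe]

theorem norm_sum_diagVecPi {𝕜 : Type*} [RCLike 𝕜] (k : ℕ) (p : ℝ≥0∞) [Fact (1 ≤ p)]
    (s : Finset ℕ) (a : ℕ → 𝕜) :
    ‖∑ n ∈ s, a n • diagVecPi 𝕜 k p n‖ =
      ‖∑ n ∈ s, a n • PiTensorProduct.tprod 𝕜 fun _ : Fin k => unitVec 𝕜 p n‖ := by
  have h1 : ∑ n ∈ s, a n • diagVecPi 𝕜 k p n =
      ((∑ n ∈ s, a n • tensorPow 𝕜 k (unitVec 𝕜 p n) : symmetricTensors 𝕜 k (ellp 𝕜 p)) :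
        Completion (symmetricTensors 𝕜 k (ellp 𝕜 p))) := by
    change _ = Completion.toComplL (𝕜 := 𝕜) _
    rw [map_sum]
    simp_rw [map_smul]
    rfl
  rw [h1]
  refine (Completion.norm_coe _).trans ((Submodule.coe_norm _).trans ?_)
  rw [Submodule.coe_sum]
  rfl

theorem toReal_le_mul_toReal_div {k : ℕ} (hk : 1 ≤ k) (p : ℝ≥0∞) :
    p.toReal ≤ k * (p / k).toReal := by
  have hk0 : (k : ℝ) ≠ 0 := by exact_mod_cast (by omega : k ≠ 0)
  rw [ENNReal.toReal_div, ENNReal.toReal_natCast, mul_div_cancel₀ _ hk0]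

theorem toReal_le_mul_toReal_one {k : ℕ} {p : ℝ≥0∞} (h : p ≤ k) :
    p.toReal ≤ k * (1 : ℝ≥0∞).toReal := by
  have := ENNReal.toReal_mono (ENNReal.natCast_ne_top k) h
  simpa using this

theorem exists_tensorDiagonal_linearIsometryEquiv {𝕜 : Type*} [RCLike 𝕜] {k : ℕ}
    {p q : ℝ≥0∞} [Fact (1 ≤ p)] [Fact (1 ≤ q)] (hq : q ≠ ⊤)
    (h : ∀ (s : Finset ℕ) (a : ℕ → 𝕜),
      ‖∑ n ∈ s, a n • symmetricTensorPow 𝕜 k (unitVec 𝕜 p n)‖ =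
        ‖∑ n ∈ s, a n • unitVec 𝕜 q n‖) :
    ∃ T : tensorDiagonal 𝕜 k p ≃ₗᵢ[𝕜] ellp 𝕜 q,
      ∀ n : ℕ, (T.symm (unitVec 𝕜 q n)).1 = diagVec 𝕜 k p n :=
  exists_closedSpan_linearIsometryEquiv_ellp (𝕜 := 𝕜) q hq (diagVec 𝕜 k p) fun s a =>
    (norm_sum_diagVec k p s a).trans (h s a)

theorem exists_tensorDiagonalPi_linearIsometryEquiv {𝕜 : Type*} [RCLike 𝕜] {k : ℕ}
    {p q : ℝ≥0∞} [Fact (1 ≤ p)] [Fact (1 ≤ q)] (hq : q ≠ ⊤)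
    (h : ∀ (s : Finset ℕ) (a : ℕ → 𝕜),
      ‖∑ n ∈ s, a n • PiTensorProduct.tprod 𝕜 fun _ : Fin k => unitVec 𝕜 p n‖ =
        ‖∑ n ∈ s, a n • unitVec 𝕜 q n‖) :
    ∃ T : tensorDiagonalPi 𝕜 k p ≃ₗᵢ[𝕜] ellp 𝕜 q,
      ∀ n : ℕ, (T.symm (unitVec 𝕜 q n)).1 = diagVecPi 𝕜 k p n :=
  exists_closedSpan_linearIsometryEquiv_ellp (𝕜 := 𝕜) q hq (diagVecPi 𝕜 k p) fun s a =>
    (norm_sum_diagVecPi k p s a).trans (h s a)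

theorem theorem2p1 (k : ℕ) (hk : 1 ≤ k) (p : ℝ≥0∞) [Fact (1 ≤ p)] (hp : p ≠ ⊤) :
    -- complex scalars, symmetric projective norm `π_s`
    ((∀ h : (k : ℝ≥0∞) < p,
        haveI : Fact (1 ≤ p / k) := fact_one_le_div h
        ∃ T : tensorDiagonal ℂ k p ≃ₗᵢ[ℂ] ellp ℂ (p / k),
          ∀ n : ℕ, (T.symm (unitVec ℂ (p / k) n)).1 = diagVec ℂ k p n) ∧
      (p ≤ k →
        ∃ T : tensorDiagonal ℂ k p ≃ₗᵢ[ℂ] ellp ℂ 1,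
          ∀ n : ℕ, (T.symm (unitVec ℂ 1 n)).1 = diagVec ℂ k p n)) ∧
    -- real or complex scalars, restriction of the projective norm `π`
    (∀ (𝕜 : Type) [RCLike 𝕜],
      (∀ h : (k : ℝ≥0∞) < p,
        haveI : Fact (1 ≤ p / k) := fact_one_le_div h
        ∃ T : tensorDiagonalPi 𝕜 k p ≃ₗᵢ[𝕜] ellp 𝕜 (p / k),
          ∀ n : ℕ, (T.symm (unitVec 𝕜 (p / k) n)).1 = diagVecPi 𝕜 k p n) ∧
      (p ≤ k →
        ∃ T : tensorDiagonalPi 𝕜 k p ≃ₗᵢ[𝕜] ellp 𝕜 1,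
          ∀ n : ℕ, (T.symm (unitVec 𝕜 1 n)).1 = diagVecPi 𝕜 k p n)) := by
  have htop : p / (k : ℝ≥0∞) ≠ ⊤ := ENNReal.div_ne_top hp (by exact_mod_cast (by omega : k ≠ 0))
  refine ⟨⟨fun h => ?_, fun h => ?_⟩, fun 𝕜 _ => ⟨fun h => ?_, fun h => ?_⟩⟩
  · have : Fact (1 ≤ p / k) := fact_one_le_div h
    refine exists_tensorDiagonal_linearIsometryEquiv htop fun s a => ?_
    exact le_antisymm (norm_sum_symmetricTensorPow_le_of_lt hk hp s a)
      (norm_sum_unitVec_le_norm_sum_symmetricTensorPow hp htop hk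
        (toReal_le_mul_toReal_div hk p) s a)
  · refine exists_tensorDiagonal_linearIsometryEquiv ENNReal.one_ne_top fun s a => ?_
    refine le_antisymm ?_ (norm_sum_unitVec_le_norm_sum_symmetricTensorPow hp
      ENNReal.one_ne_top hk (toReal_le_mul_toReal_one h) s a)
    rw [norm_sum_unitVec_one]
    exact norm_sum_symmetricTensorPow_le_sum k s a
  · have : Fact (1 ≤ p / k) := fact_one_le_div h
    refine exists_tensorDiagonalPi_linearIsometryEquiv htop fun s a => ?_
    exact le_antisymm (norm_sum_tprod_le_of_lt hk hp s a)
      (norm_sum_unitVec_le_norm_sum_tprod hp htop hk (toReal_le_mul_toReal_div hk p) s a)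
  · refine exists_tensorDiagonalPi_linearIsometryEquiv ENNReal.one_ne_top fun s a => ?_
    refine le_antisymm ?_ (norm_sum_unitVec_le_norm_sum_tprod hp ENNReal.one_ne_top hk
      (toReal_le_mul_toReal_one h) s a)
    rw [norm_sum_unitVec_one]
    exact norm_sum_tprod_le_sum k s a
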